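/- Let $(X_n)_n$ be a countable (finite or countably infinite) family of metric spaces and let $X=\prod_n X_n$ carry the product topology. Let $B_b$, $C_b$ and $U_b$ be the sets of bounded functions $f:X\to\mathbb{R}$ that are Borel measurable, continuous and upper semicontinuous, respectively. Let $B_{b,n}^+$ be the set of bounded Borel measurable functions $X_n\to[0,\infty)$, and let $ca^+$ be the set of finite Borel measures on $X$. Write $\langle f,\mu\rangle=\int f\,d\mu$; for $g=(g_n)_n$ with $g_n\in B^+_{b,n}$ write $\oplus g(x)=\sum_n g_n(x_n)\in[0,\infty]$; and write $f_j\downarrow f$ if $(f_j)_{j\in\mathbb{N}}$ is a decreasing sequence converging pointwise to $f$. For every $n$ let $\phi_n:B^+_{b,n}\to[0,\infty)$ be a map such that for all real $m,\varepsilon>0$ there is a compact set $K_n\subseteq X_n$ with $\phi_n(m1_{K_n^c})\le\varepsilon$. Let $\phi:B_b\to\mathbb{R}$ be convex and increasing (that is, $\phi(f)\ge\phi(g)$ whenever $f\ge g$ pointwise), and suppose that $\phi(f)\le\sum_n\phi_n(g_n)$ for all $f\in B_b$ and all $g_n\in B^+_{b,n}$ with $f\le\oplus g$. For $\mu\in ca^+$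 define $$\phi^*_{C_b}(\mu)=\sup_{f\in C_b}\big(\langle f,\mu\rangle-\phi(f)\big),\qquad \phi^*_{U_b}(\mu)=\sup_{f\in U_b}\big(\langle f,\mu\rangle-\phi(f)\big),$$ with values in $\mathbb{R}\cup\{+\infty\}$. Then for every $a\in\mathbb{R}$ the set $\Lambda_a=\{\mu\in ca^+:\phi^*_{C_b}(\mu)\le a\}$ is sequentially compact, that is, every sequence in $\Lambda_a$ has a subsequence converging to some $\mu\in\Lambda_a$ in the topology $\sigma(ca^+,C_b)$. Moreover, the following four conditions are equivalent: (i) $\phi(f)=\max_{\mu\in ca^+}\big(\langle f,\mu\rangle-\phi^*_{C_b}(\mu)\big)$ for all $f\in U_b$ (the maximum being attained); (ii) $\phi(f_j)\downarrow\phi(f)$ for all $f\in U_b$ and every sequence $(f_j)$ in $C_b$ with $f_j\downarrow f$; (iii) $\phi(f)=\inf\{\phi(g):g\in C_b,\ g\ge f\}$ for all $f\in U_b$; (iv) $\phi^*_{C_b}(\mu)=\phi^*_{U_b}(\mu)$ for all $\mu\in ca^+$. -/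

import Mathlib

open MeasureTheory Filter Topology
open scoped NNReal ENNReal

/-- The product `∏ n, X n`. It is a type synonym, so that it can carry the Borel σ-algebra of the
product topology (which for non-separable factors may be larger than the product σ-algebra). -/
def ProductSpace {ι : Type*} (X : ι → Type*) : Type _ := ∀ n, X n

instance ProductSpace.instTopologicalSpace {ι : Type*} (X : ι → Type*)
    [∀ n, TopologicalSpace (X n)] : TopologicalSpace (ProductSpace X) :=
  inferInstanceAs (TopologicalSpace (∀ n, X n))

instance ProductSpace.instMeasurableSpace {ι : Type*} (X : ι → Type*)
    [∀ n, TopologicalSpace (X n)] : MeasurableSpace (ProductSpace X) :=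
  borel (ProductSpace X)

instance ProductSpace.instBorelSpace {ι : Type*} (X : ι → Type*)
    [∀ n, TopologicalSpace (X n)] : BorelSpace (ProductSpace X) :=
  ⟨rfl⟩

/-- `B_b`: the ordered vector space of bounded measurable functions `Y → ℝ`. -/
def Bb (Y : Type*) [MeasurableSpace Y] : Submodule ℝ (Y → ℝ) where
  carrier := {f | Measurable f ∧ ∃ C : ℝ, ∀ y, |f y| ≤ C}
  zero_mem' := ⟨measurable_const, 0, fun y => by simp⟩
  add_mem' := by
    rintro f g ⟨hf, C, hC⟩ ⟨hg, D, hD⟩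
    exact ⟨hf.add hg, C + D, fun y => (abs_add_le _ _).trans (add_le_add (hC y) (hD y))⟩
  smul_mem' := by
    rintro c f ⟨hf, C, hC⟩
    refine ⟨hf.const_smul c, |c| * C, fun y => ?_⟩
    simpa [abs_mul] using mul_le_mul_of_nonneg_left (hC y) (abs_nonneg c)

/-- `C_b`: the bounded continuous functions, as a subset of `B_b`. -/
def Cb (Y : Type*) [TopologicalSpace Y] [MeasurableSpace Y] : Set (Bb Y) :=
  {f | Continuous (f : Y → ℝ)}

/-- `U_b`: the bounded upper semicontinuous functions, as a subset of `B_b`. -/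
def Ub (Y : Type*) [TopologicalSpace Y] [MeasurableSpace Y] : Set (Bb Y) :=
  {f | UpperSemicontinuous (f : Y → ℝ)}

/-- On a Borel space, every bounded continuous function is an element of `B_b`. -/
theorem mem_Bb_of_continuous {Y : Type*} [TopologicalSpace Y] [MeasurableSpace Y] [BorelSpace Y]
    {f : Y → ℝ} (hf : Continuous f) (hb : ∃ C : ℝ, ∀ y, |f y| ≤ C) : f ∈ Bb Y :=
  ⟨hf.measurable, hb⟩

/-- On a Borel space, every bounded upper semicontinuous function is an element of `B_b`. -/
theorem mem_Bb_of_upperSemicontinuous {Y : Type*} [TopologicalSpace Y] [MeasurableSpace Y]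
    [BorelSpace Y] {f : Y → ℝ} (hf : UpperSemicontinuous f) (hb : ∃ C : ℝ, ∀ y, |f y| ≤ C) :
    f ∈ Bb Y :=
  ⟨hf.measurable, hb⟩

/-- `B_b⁺`: the bounded measurable functions `Y → [0, ∞)`. -/
def BbPos (Y : Type*) [MeasurableSpace Y] : Type _ :=
  {g : Y → ℝ≥0 // Measurable g ∧ ∃ C : ℝ≥0, ∀ y, g y ≤ C}

/-- The function `c 1_s`, as an element of `B_b⁺`. -/
noncomputable def BbPos.indicatorConst {Y : Type*} [MeasurableSpace Y] (s : Set Y)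
    (hs : MeasurableSet s) (c : ℝ≥0) : BbPos Y :=
  ⟨s.indicator fun _ => c, measurable_const.indicator hs, c,
    fun _ => Set.indicator_le_self' (fun _ _ => zero_le) _⟩

/-- `⊕ g = ∑ n, g n ∘ π n`, with values in `[0, ∞]`. -/
noncomputable def oplus {ι : Type*} {X : ι → Type*} [∀ n, MeasurableSpace (X n)]
    (g : ∀ n, BbPos (X n)) (x : ProductSpace X) : ℝ≥0∞ :=
  ∑' n, ((g n).1 (x n) : ℝ≥0∞)

/-- Tightness of a functional `ψ : B_b⁺ → [0, ∞)`: for all `m, ε > 0` there is a compact `K` with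
`ψ (m 1_{Kᶜ}) ≤ ε`. -/
def IsTightFunctional {Y : Type*} [TopologicalSpace Y] [T2Space Y] [MeasurableSpace Y]
    [BorelSpace Y] (ψ : BbPos Y → ℝ≥0) : Prop :=
  ∀ m ε : ℝ≥0, 0 < m → 0 < ε → ∃ (K : Set Y) (hK : IsCompact K),
    ψ (BbPos.indicatorConst Kᶜ hK.measurableSet.compl m) ≤ ε

/-- The convex conjugate `φ*_S(μ) = sup_{f ∈ S} (∫ f dμ - φ f)`. -/
noncomputable def convexConjugate {Y : Type*} [MeasurableSpace Y] (φ : Bb Y → ℝ) (S : Set (Bb Y))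
    (μ : FiniteMeasure Y) : EReal :=
  ⨆ f ∈ S, (((∫ y, (f : Y → ℝ) y ∂(μ : Measure Y)) - φ f : ℝ) : EReal)

/-! Choosing compact sets `K n` whose costs are summable with total below 1, the domination
hypothesis gives `φ f ≤ 1` for every continuous `f ≤ M` that is nonpositive on the compact box of
the `K n`. This is `IsTightOnCb`, and the rest needs only it, monotonicity, convexity and
metrizability of the product. A bound on the conjugate over `C_b` then bounds the mass and the tails
of a measure, so Prokhorov's theorem makes the sublevel sets sequentially compact. At continuous
`f`, Hahn–Banach provides a subgradient of `φ`. Monotonicity makes it positive and tightness makes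
it tight, so by Riesz it is a measure, which attains the dual supremum. An upper semicontinuous `f`
is a decreasing limit of continuous `F j`. A limit point of maximizers for the `F j` is a maximizer
for `f`, and the dual maximum `L` equals `lim φ (F j)`. In general only `φ f ≤ L` holds. Each of the
four conditions says that this gap vanishes for all `f` in `U_b`. -/

/-! ### Sequential compactness of sets of finite measures -/

/-- On a second countable space whose closed sets are approximable by continuous functions, there
are countably many bounded continuous functions whose integrals determine a finite measure. -/
theorem MeasureTheory.FiniteMeasure.exists_countable_separating (S : Type*) [TopologicalSpace S]
    [SecondCountableTopology S] [HasOuterApproxClosed S] [MeasurableSpace S] [BorelSpace S] :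
    ∃ f : ℕ → BoundedContinuousFunction S ℝ≥0, ∀ μ ν : FiniteMeasure S,
      (∀ n, ∫⁻ x, f n x ∂(μ : Measure S) = ∫⁻ x, f n x ∂(ν : Measure S)) → μ = ν := by
  obtain ⟨b, hbc, -, hb⟩ := TopologicalSpace.exists_countable_basis S
  -- Finite unions of basic sets are taken so that their complements are closed under intersection
  -- and form a countable π-system of closed sets.
  let B : Set (Set S) := (fun t => ⋃₀ t) '' {t | t.Finite ∧ t ⊆ b}
  have hBc : B.Countable := (Set.countable_ofPred_finite_subset hbc).image _
  have hBo : ∀ U ∈ B, IsOpen U := by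
    rintro _ ⟨t, ht, rfl⟩
    exact isOpen_sUnion fun u hu => hb.isOpen (ht.2 hu)
  let A : Set (Set S) := compl '' B
  have hAc : A.Countable := hBc.image _
  have hApi : IsPiSystem A := by
    rintro _ ⟨_, ⟨t, ht, rfl⟩, rfl⟩ _ ⟨_, ⟨u, hu, rfl⟩, rfl⟩ -
    refine ⟨_, ⟨t ∪ u, ⟨ht.1.union hu.1, Set.union_subset ht.2 hu.2⟩, rfl⟩, ?_⟩
    simp only [Set.sUnion_union, Set.compl_union]
  have hAcl : ∀ F ∈ A, IsClosed F := by
    rintro _ ⟨U, hU, rfl⟩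
    exact (hBo U hU).isClosed_compl
  have huniv : Set.univ ∈ A := ⟨∅, ⟨∅, by simp, by simp⟩, by simp⟩
  have hgen : borel S = MeasurableSpace.generateFrom A := by
    refine le_antisymm ?_ (MeasurableSpace.generateFrom_le fun F hF => ?_)
    · rw [hb.borel_eq_generateFrom]
      refine MeasurableSpace.generateFrom_le fun U hU => ?_
      rw [← compl_compl U]
      have hUA : Uᶜ ∈ A := ⟨U, ⟨{U}, by simpa using hU, by simp⟩, rfl⟩
      exact (MeasurableSpace.measurableSet_generateFrom hUA).compl
    · borelize S
      exact (hAcl F hF).measurableSet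
  obtain ⟨e, he⟩ := hAc.exists_eq_range ⟨_, huniv⟩
  have hecl : ∀ i, IsClosed (e i) := fun i => hAcl _ (he ▸ Set.mem_range_self i)
  -- The pairing encodes a closed set and a stage of its continuous approximation; the integrals
  -- over all stages determine its measure.
  refine ⟨fun n => (hecl n.unpair.1).apprSeq n.unpair.2, fun μ ν h => ?_⟩
  have hF : ∀ i, (μ : Measure S) (e i) = (ν : Measure S) (e i) := fun i => by
    refine tendsto_nhds_unique (HasOuterApproxClosed.tendsto_lintegral_apprSeq (hecl i) μ) ?_
    have := HasOuterApproxClosed.tendsto_lintegral_apprSeq (hecl i) (ν : Measure S)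
    refine this.congr fun n => ?_
    simpa using (h (Nat.pair i n)).symm
  refine FiniteMeasure.toMeasure_injective
    (ext_of_generate_finite A (BorelSpace.measurable_eq.trans hgen) hApi ?_ ?_)
  · intro F hFA
    obtain ⟨i, rfl⟩ := he ▸ hFA
    exact hF i
  · obtain ⟨i, hi⟩ := he ▸ huniv
    rw [← hi]
    exact hF i

/-- A compact set of finite measures on a separable metrizable space is sequentially compact. -/
theorem IsCompact.isSeqCompact_finiteMeasure {S : Type*} [TopologicalSpace S]
    [SecondCountableTopology S] [HasOuterApproxClosed S] [MeasurableSpace S] [BorelSpace S]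
    {P : Set (FiniteMeasure S)} (hP : IsCompact P) : IsSeqCompact P := by
  obtain ⟨f, hf⟩ := FiniteMeasure.exists_countable_separating S
  have : CompactSpace P := isCompact_iff_compactSpace.1 hP
  -- A compact space with countably many continuous real functions separating points is metrizable,
  -- and there compactness gives sequential compactness.
  have : TopologicalSpace.MetrizableSpace P :=
    Metric.PiNatEmbed.TopologicalSpace.MetrizableSpace.of_countable_separating
      (fun n (μ : P) => (μ : FiniteMeasure S).testAgainstNN (f n))
      (fun n => (FiniteMeasure.continuous_testAgainstNN_eval (f n)).comp continuous_subtype_val)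
      fun μ ν hμν => by
        by_contra! h
        refine hμν (Subtype.ext (hf _ _ fun n => ?_))
        rw [← FiniteMeasure.testAgainstNN_coe_eq, ← FiniteMeasure.testAgainstNN_coe_eq, h n]
  exact isSeqCompact_iff_seqCompactSpace.2 inferInstance

/-- **Prokhorov's theorem**, sequential version on a metrizable space (not assumed separable). -/
theorem isSeqCompact_finiteMeasure_mass_le_compl_isCompact_le {Y : Type*} [TopologicalSpace Y]
    [TopologicalSpace.MetrizableSpace Y] [MeasurableSpace Y] [BorelSpace Y]
    {u : ℕ → ℝ≥0} {K : ℕ → Set Y} (C : ℝ≥0) (hu : Tendsto u atTop (𝓝 0))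
    (hK : ∀ n, IsCompact (K n)) :
    IsSeqCompact {μ : FiniteMeasure Y | μ.mass ≤ C ∧ ∀ n, μ (K n)ᶜ ≤ u n} := by
  -- Since `u` tends to 0, every measure in the set is carried by this σ-compact, hence separable,
  -- subspace. The set is therefore a continuous image of its analogue on `S`.
  let S : Set Y := ⋃ n, K n
  have hKS : ∀ n, K n ⊆ S := fun n => Set.subset_iUnion K n
  have hSm : MeasurableSet S := .iUnion fun n => (hK n).measurableSet
  have hsep : TopologicalSpace.IsSeparable S := .iUnion fun n => (hK n).isSeparable
  have : SecondCountableTopology S := hsep.secondCountableTopology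
  let K' : ℕ → Set S := fun n => Subtype.val ⁻¹' K n
  have hK' : ∀ n, IsCompact (K' n) := fun n => by
    rw [Subtype.isCompact_iff, Subtype.image_preimage_coe, Set.inter_eq_right.2 (hKS n)]
    exact hK n
  have hval : MeasurableEmbedding (Subtype.val : S → Y) := .subtype_coe hSm
  let P : Set (FiniteMeasure S) := {μ | μ.mass ≤ C ∧ ∀ n, μ (K' n)ᶜ ≤ u n}
  have hP : IsSeqCompact P := IsCompact.isSeqCompact_finiteMeasure <| by
    let := TopologicalSpace.metrizableSpaceMetric S
    exact isCompact_setOfPred_finiteMeasure_mass_le_compl_isCompact_le C hu hK' (.inl inferInstance)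
  have hmap : Continuous fun ν : FiniteMeasure S => ν.map Subtype.val :=
    FiniteMeasure.continuous_map continuous_subtype_val
  suffices h : {μ : FiniteMeasure Y | μ.mass ≤ C ∧ ∀ n, μ (K n)ᶜ ≤ u n}
      = (fun ν : FiniteMeasure S => ν.map Subtype.val) '' P by
    rw [h]
    exact hP.image hmap.seqContinuous
  ext μ
  constructor
  · rintro ⟨hm, hμ⟩
    have h0 : (μ : Measure Y) Sᶜ = 0 := by
      have h1 : ∀ n, μ Sᶜ ≤ u n := fun n =>
        (FiniteMeasure.apply_mono _ (Set.compl_subset_compl.2 (hKS n))).trans (hμ n)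
      have h2 : μ Sᶜ ≤ 0 := ge_of_tendsto' hu h1
      exact (FiniteMeasure.null_iff_toMeasure_null μ _).1 (le_antisymm h2 zero_le)
    have hae : ∀ᵐ y ∂(μ : Measure Y), y ∈ S := h0
    refine ⟨μ.comap Subtype.val, ⟨(FiniteMeasure.mass_comap_le _ _).trans hm, fun n => ?_⟩, ?_⟩
    · refine le_trans ?_ (hμ n)
      rw [← ENNReal.coe_le_coe]
      simp only [FiniteMeasure.ennreal_coeFn_eq_coeFn_toMeasure, FiniteMeasure.toMeasure_comap]
      rw [hval.comap_apply]
      refine measure_mono ?_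
      rintro _ ⟨y, hy, rfl⟩
      exact hy
    · refine FiniteMeasure.toMeasure_injective ?_
      change ((μ.comap (Subtype.val : S → Y)).map Subtype.val : Measure Y) = μ
      simp only [FiniteMeasure.toMeasure_map, FiniteMeasure.toMeasure_comap]
      rw [map_comap_subtype_coe hSm, Measure.restrict_eq_self_of_ae_mem hae]
  · rintro ⟨ν, ⟨hm, hν⟩, rfl⟩
    refine ⟨(FiniteMeasure.mass_map_le _ _).trans hm, fun n => ?_⟩
    rw [FiniteMeasure.map_apply _ measurable_subtype_coe (hK n).measurableSet.compl]
    exact hν n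

/-! ### Riesz representation through the Stone–Čech compactification -/

/-- A tight positive linear functional on the bounded continuous functions of a completely regular
Hausdorff space is integration against a finite Borel measure. -/
theorem exists_finiteMeasure_of_tight_positive_functional {Y : Type*} [TopologicalSpace Y]
    [T35Space Y] [MeasurableSpace Y] [BorelSpace Y]
    (l : BoundedContinuousFunction Y ℝ →ₗ[ℝ] ℝ) (hpos : ∀ f, 0 ≤ f → 0 ≤ l f)
    (htight : ∀ ε : ℝ, 0 < ε → ∃ K : Set Y, IsCompact K ∧
      ∀ f : BoundedContinuousFunction Y ℝ, f ≤ 1 → (∀ y ∈ K, f y ≤ 0) → l f ≤ ε) :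
    ∃ μ : FiniteMeasure Y, ∀ f, l f = ∫ y, f y ∂(μ : Measure Y) := by
  borelize (StoneCech Y)
  let ι : Y → StoneCech Y := stoneCechUnit
  have hι : IsEmbedding ι := isEmbedding_stoneCechUnit
  let R : CompactlySupportedContinuousMap (StoneCech Y) ℝ → BoundedContinuousFunction Y ℝ :=
    fun g => g.toBoundedContinuousFunction.compContinuous ⟨ι, hι.continuous⟩
  have hRapp : ∀ g y, R g y = g (ι y) := fun g y => rfl
  let Λ : CompactlySupportedContinuousMap (StoneCech Y) ℝ →ₚ[ℝ] ℝ :=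
    { toFun := fun g => l (R g)
      map_add' := fun g h => by rw [← map_add]; rfl
      map_smul' := fun c g => by rw [RingHom.id_apply, ← map_smul]; rfl
      monotone' := fun g h hgh => by
        have := hpos (R h - R g) fun y => sub_nonneg.2 (hgh (ι y))
        rw [map_sub] at this
        exact sub_nonneg.1 this }
  let ν : Measure (StoneCech Y) := RealRMK.rieszMeasure Λ
  have hνt : ∀ K : Set Y, IsCompact K → ∀ ε : ℝ, (∀ f : BoundedContinuousFunction Y ℝ, f ≤ 1 →
      (∀ y ∈ K, f y ≤ 0) → l f ≤ ε) → ν (ι '' K)ᶜ ≤ ENNReal.ofReal ε := by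
    intro K hK ε hε
    have hKc : IsClosed (ι '' K) := (hK.image hι.continuous).isClosed
    -- By inner regularity it suffices to bound compact sets `L` off `ι '' K`. A Urysohn function
    -- that is 1 on `L` and 0 on `ι '' K` restricts to a test function for `hε`.
    rw [hKc.isOpen_compl.measure_eq_iSup_isCompact]
    refine iSup₂_le fun L hL => iSup_le fun hLc => ?_
    obtain ⟨g, hg0, hg1, hg⟩ := exists_continuous_zero_one_of_isClosed hKc hLc.isClosed
      (Set.disjoint_left.2 fun x hx hx' => hL hx' hx)
    let g' : CompactlySupportedContinuousMap (StoneCech Y) ℝ :=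
      ⟨g, HasCompactSupport.of_compactSpace _⟩
    refine (RealRMK.rieszMeasure_le_of_eq_one Λ (f := g') (fun x => (hg x).1) hLc
      fun x hx => hg1 hx).trans (ENNReal.ofReal_le_ofReal ?_)
    refine hε (R g') (fun y => (hg (ι y)).2) fun y hy => (hg0 (Set.mem_image_of_mem ι hy)).le
  choose! K hK hKl using htight
  let ε : ℕ → ℝ := fun n => 1 / (n + 1)
  have hε : ∀ n, 0 < ε n := fun n => Nat.one_div_pos_of_nat
  let S : Set Y := ⋃ n, K (ε n)
  have hSm : MeasurableSet S := .iUnion fun n => (hK _ (hε n)).measurableSet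
  have hιS : ι '' S = ⋃ n, ι '' K (ε n) := Set.image_iUnion
  have hιSm : MeasurableSet (ι '' S) := by
    rw [hιS]
    exact .iUnion fun n => ((hK _ (hε n)).image hι.continuous).measurableSet
  have hν0 : ν (ι '' S)ᶜ = 0 := by
    have h1 : ∀ n, ν (ι '' S)ᶜ ≤ ENNReal.ofReal (ε n) := fun n =>
      (measure_mono (Set.compl_subset_compl.2
        (Set.image_mono (Set.subset_iUnion (fun n => K (ε n)) n)))).trans
        (hνt _ (hK _ (hε n)) _ (hKl _ (hε n)))
    have h2 : Tendsto (fun n => ENNReal.ofReal (ε n)) atTop (𝓝 0) := by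
      simpa [ε] using ENNReal.tendsto_ofReal tendsto_one_div_add_atTop_nhds_zero_nat
    exact le_antisymm (ge_of_tendsto' h2 h1) zero_le
  -- The measure is pulled back to `S` rather than to `Y`: `ι '' S` is σ-compact, hence Borel,
  -- whereas `ι '' Y` need not be.
  let j : S → StoneCech Y := fun s => ι s
  have hjr : Set.range j = ι '' S := by
    simp only [j]
    rw [Set.range_comp' ι, Subtype.range_coe]
  have hj : MeasurableEmbedding j :=
    (hι.comp .subtypeVal).measurableEmbedding (hjr ▸ hιSm)
  have : IsFiniteMeasure (ν.comap j) := by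
    refine ⟨?_⟩
    rw [hj.comap_apply]
    exact measure_lt_top ν _
  refine ⟨⟨(ν.comap j).map Subtype.val, inferInstance⟩, fun f => ?_⟩
  have hfI : ∀ y, f y ∈ Set.Icc (-‖f‖) ‖f‖ := fun y => abs_le.1 (f.norm_coe_le_norm y)
  have hfc : Continuous fun y => (⟨f y, hfI y⟩ : Set.Icc (-‖f‖) ‖f‖) :=
    f.continuous.subtype_mk _
  let g : CompactlySupportedContinuousMap (StoneCech Y) ℝ :=
    ⟨⟨fun z => ((stoneCechExtend hfc z : Set.Icc (-‖f‖) ‖f‖) : ℝ),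
      continuous_subtype_val.comp (continuous_stoneCechExtend hfc)⟩,
      HasCompactSupport.of_compactSpace _⟩
  have hg : ∀ y, g (ι y) = f y := fun y =>
    congrArg Subtype.val (stoneCechExtend_stoneCechUnit hfc y)
  have hRg : R g = f := by
    ext y
    exact hg y
  calc l f = Λ g := by rw [← hRg]; rfl
    _ = ∫ z, g z ∂ν := (RealRMK.integral_rieszMeasure Λ g).symm
    _ = ∫ z, g z ∂((ν.comap j).map j) := by
      rw [hj.map_comap, hjr, Measure.restrict_eq_self_of_ae_mem]
      exact hν0
    _ = ∫ s, f s ∂(ν.comap j) := by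
      rw [hj.integral_map]
      exact integral_congr_ae (.of_forall fun s => hg s)
    _ = _ := by
      change _ = ∫ y, f y ∂((ν.comap j).map Subtype.val)
      rw [(MeasurableEmbedding.subtype_coe hSm).integral_map]

/-! ### Algebraic subgradients -/

/-- A real-valued convex function on a real vector space has an algebraic subgradient at every
point. -/
theorem ConvexOn.exists_linear_subgradient {E : Type*} [AddCommGroup E] [Module ℝ E] {φ : E → ℝ}
    (hφ : ConvexOn ℝ Set.univ φ) (x : E) :
    ∃ l : E →ₗ[ℝ] ℝ, ∀ y, φ x + l (y - x) ≤ φ y := by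
  -- The infimum of these quotients over `t` is the directional derivative at `x`. It is sublinear
  -- in `h`, so Hahn–Banach, started from the zero subspace, yields a linear functional below it.
  let D : E → {t : ℝ // 0 < t} → ℝ := fun h t => (φ (x + t.1 • h) - φ x) / t.1
  have key : ∀ (h k : E) (t s : {t : ℝ // 0 < t}), ∃ r, D (h + k) r ≤ D h t + D k s := by
    rintro h k ⟨t, ht⟩ ⟨s, hs⟩
    have hst : 0 < s + t := add_pos hs ht
    -- With weights `s / (s + t)` and `t / (s + t)`, the steps `t • h` and `s • k` average to this
    -- multiple of `h + k`.
    refine ⟨⟨t * s / (s + t), by positivity⟩, ?_⟩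
    have h1 : φ ((s / (s + t)) • (x + t • h) + (t / (s + t)) • (x + s • k))
        ≤ (s / (s + t)) • φ (x + t • h) + (t / (s + t)) • φ (x + s • k) :=
      hφ.2 trivial trivial (by positivity) (by positivity) (by field_simp)
    have h2 : (s / (s + t)) • (x + t • h) + (t / (s + t)) • (x + s • k)
        = x + (t * s / (s + t)) • (h + k) := by
      have : x = (s / (s + t)) • x + (t / (s + t)) • x := by
        rw [← add_smul, ← add_div, div_self hst.ne', one_smul]
      conv_rhs => rw [this]
      module
    rw [h2] at h1
    simp only [D]
    rw [div_le_iff₀ (by positivity)]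
    simp only [smul_eq_mul] at h1
    have h3 : ((φ (x + t • h) - φ x) / t + (φ (x + s • k) - φ x) / s) * (t * s / (s + t))
        = s / (s + t) * φ (x + t • h) + t / (s + t) * φ (x + s • k) - φ x := by
      field_simp
      ring
    linarith
  have hbdd : ∀ h, BddBelow (Set.range (D h)) := by
    intro h
    refine ⟨-D (-h) ⟨1, one_pos⟩, ?_⟩
    rintro _ ⟨t, rfl⟩
    obtain ⟨r, hr⟩ := key h (-h) t ⟨1, one_pos⟩
    have : D (h + -h) r = 0 := by simp [D]
    linarith
  have : Nonempty {t : ℝ // 0 < t} := ⟨⟨1, one_pos⟩⟩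
  have hhom : ∀ c : ℝ, 0 < c → ∀ h, ⨅ t, D (c • h) t ≤ c * ⨅ t, D h t := by
    intro c hc h
    rw [Real.mul_iInf_of_nonneg hc.le]
    refine le_ciInf fun t => (ciInf_le (hbdd _) ⟨t.1 / c, div_pos t.2 hc⟩).trans_eq ?_
    have := t.2.ne'
    simp only [D, smul_smul, div_mul_cancel₀ _ hc.ne']
    field_simp
  obtain ⟨l, -, hl⟩ := exists_extension_of_le_sublinear (⊥ : E →ₗ.[ℝ] ℝ) (fun h => ⨅ t, D h t)
    (fun c hc h => by
      refine (hhom c hc h).antisymm ?_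
      have := hhom c⁻¹ (inv_pos.2 hc) (c • h)
      rw [smul_smul, inv_mul_cancel₀ hc.ne', one_smul] at this
      calc c * ⨅ t, D h t ≤ c * (c⁻¹ * ⨅ t, D (c • h) t) := by gcongr
        _ = _ := by field_simp)
    (fun h k => le_ciInf_add_ciInf fun t s => by
      obtain ⟨r, hr⟩ := key h k t s
      exact (ciInf_le (hbdd _) r).trans hr)
    (fun h => by
      obtain ⟨h, hh⟩ := h
      obtain rfl : h = 0 := (Submodule.mem_bot ℝ).1 hh
      have h0 : ((⊥ : E →ₗ.[ℝ] ℝ) ⟨0, hh⟩ : ℝ) = 0 := LinearPMap.map_zero _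
      rw [h0]
      simp [D])
  refine ⟨l, fun y => ?_⟩
  have h1 := (hl (y - x)).trans (ciInf_le (hbdd _) ⟨1, one_pos⟩)
  simp only [D, one_smul, div_one, add_sub_cancel] at h1
  linarith

/-! ### Approximation of upper semicontinuous functions -/

/-- A bounded upper semicontinuous function on a metrizable space is the pointwise limit of a
decreasing sequence of bounded continuous functions. -/
theorem UpperSemicontinuous.exists_antitone_boundedContinuousFunction {Y : Type*}
    [TopologicalSpace Y] [TopologicalSpace.MetrizableSpace Y] {f : Y → ℝ}
    (hf : UpperSemicontinuous f) (hb : ∃ C : ℝ, ∀ y, |f y| ≤ C) :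
    ∃ F : ℕ → BoundedContinuousFunction Y ℝ, Antitone F ∧
      ∀ y, Tendsto (fun j => F j y) atTop (𝓝 (f y)) := by
  let := TopologicalSpace.metrizableSpaceMetric Y
  obtain ⟨C, hC⟩ := hb
  -- The sup-convolution of `f` with `j * dist` is `j`-Lipschitz, dominates `f` and decreases in
  -- `j`.
  let G : ℕ → Y → ℝ := fun j x => ⨆ y, (f y - j * dist x y)
  have hbd : ∀ (j : ℕ) x, BddAbove (Set.range fun y => f y - j * dist x y) := by
    rintro j x
    refine ⟨C, ?_⟩
    rintro _ ⟨y, rfl⟩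
    have := le_of_abs_le (hC y)
    have : 0 ≤ j * dist x y := by positivity
    dsimp only
    linarith
  have hfG : ∀ j x, f x ≤ G j x := fun j x => by
    simpa using le_ciSup (hbd j x) x
  have hGle : ∀ j x, G j x ≤ C := fun j x => by
    have : Nonempty Y := ⟨x⟩
    refine ciSup_le fun y => ?_
    have := le_of_abs_le (hC y)
    have : 0 ≤ j * dist x y := by positivity
    linarith
  have hlip : ∀ j : ℕ, LipschitzWith j (G j) := fun j => by
    refine LipschitzWith.of_le_add_mul _ fun x x' => ?_
    have : Nonempty Y := ⟨x⟩
    refine ciSup_le fun y => ?_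
    have h1 := le_ciSup (hbd j x') y
    have h2 : (j : ℝ) * dist x' y ≤ j * (dist x x' + dist x y) := by
      gcongr
      exact (dist_triangle_left x' y x)
    simp only [NNReal.coe_natCast]
    change _ ≤ G j x' + _
    change _ ≤ G j x' at h1
    linarith
  refine ⟨fun j => BoundedContinuousFunction.ofNormedAddCommGroup (G j) (hlip j).continuous C
    fun x => ?_, ?_, ?_⟩
  · rw [Real.norm_eq_abs, abs_le]
    exact ⟨(neg_le_of_abs_le (hC x)).trans (hfG j x), hGle j x⟩
  · intro i j hij x
    have : Nonempty Y := ⟨x⟩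
    change G j x ≤ G i x
    refine ciSup_mono (hbd i x) fun y => ?_
    gcongr
  · intro x
    have : Nonempty Y := ⟨x⟩
    change Tendsto (fun j => G j x) atTop _
    refine tendsto_order.2 ⟨fun a ha => .of_forall fun j => ha.trans_le (hfG j x), fun a ha => ?_⟩
    obtain ⟨b, hb1, hb2⟩ := exists_between ha
    obtain ⟨δ, hδ, hball⟩ := Metric.eventually_nhds_iff.1 (hf x b hb1)
    -- Past this `N` the penalty at distance at least `δ` exceeds `C - b`, so only points where `f <
    -- b` matter.
    obtain ⟨N, hN⟩ := exists_nat_gt ((C - b) / δ)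
    filter_upwards [eventually_ge_atTop N] with j hj
    refine lt_of_le_of_lt (ciSup_le fun y => ?_) hb2
    by_cases hy : dist y x < δ
    · have := (hball hy).le
      have : 0 ≤ j * dist x y := by positivity
      linarith
    · have h1 : (N : ℝ) * δ ≤ j * dist x y := by
        rw [dist_comm]
        push Not at hy
        gcongr
      have h2 := (div_lt_iff₀ hδ).1 hN
      have := le_of_abs_le (hC y)
      linarith

/-! ### Bounded functions, conjugates and duality -/

/-- The inclusion of the bounded continuous functions in `B_b`. -/
def BoundedContinuousFunction.toBb {Y : Type*} [TopologicalSpace Y] [MeasurableSpace Y]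
    [BorelSpace Y] : BoundedContinuousFunction Y ℝ →ₗ[ℝ] Bb Y where
  toFun f := ⟨f, mem_Bb_of_continuous f.continuous ⟨‖f‖, f.norm_coe_le_norm⟩⟩
  map_add' _ _ := rfl
  map_smul' _ _ := rfl

theorem Bb.integrable {Y : Type*} [MeasurableSpace Y] (f : Bb Y) (μ : FiniteMeasure Y) :
    Integrable (f : Y → ℝ) (μ : Measure Y) := by
  obtain ⟨C, hC⟩ := f.2.2
  exact .of_bound f.2.1.aestronglyMeasurable C (.of_forall hC)

theorem convexConjugate_le_iff {Y : Type*} [MeasurableSpace Y] {φ : Bb Y → ℝ}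
    {S : Set (Bb Y)} {μ : FiniteMeasure Y} {a : ℝ} :
    convexConjugate φ S μ ≤ a ↔ ∀ f ∈ S, ∫ y, (f : Y → ℝ) y ∂(μ : Measure Y) - φ f ≤ a := by
  simp only [convexConjugate, iSup_le_iff, EReal.coe_le_coe_iff]

theorem le_convexConjugate {Y : Type*} [MeasurableSpace Y] (φ : Bb Y → ℝ)
    {S : Set (Bb Y)} (μ : FiniteMeasure Y) {f : Bb Y} (hf : f ∈ S) :
    ((∫ y, (f : Y → ℝ) y ∂(μ : Measure Y) - φ f : ℝ) : EReal) ≤ convexConjugate φ S μ :=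
  le_iSup₂_of_le f hf le_rfl

section Duality

variable {Y : Type*} [TopologicalSpace Y] [MeasurableSpace Y] [BorelSpace Y]

open BoundedContinuousFunction

theorem toBb_mono {f g : BoundedContinuousFunction Y ℝ} (h : f ≤ g) : toBb f ≤ toBb g := h

theorem toBb_mem_Cb (f : BoundedContinuousFunction Y ℝ) : toBb f ∈ Cb Y := f.continuous

theorem exists_toBb_eq {f : Bb Y} (hf : f ∈ Cb Y) : ∃ g, toBb g = f := by
  obtain ⟨C, hC⟩ := f.2.2
  exact ⟨.ofNormedAddCommGroup f hf C hC, rfl⟩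

theorem convexConjugate_Cb_le_iff {φ : Bb Y → ℝ} {μ : FiniteMeasure Y} {a : ℝ} :
    convexConjugate φ (Cb Y) μ ≤ a ↔
      ∀ f : BoundedContinuousFunction Y ℝ, ∫ y, f y ∂(μ : Measure Y) - φ (toBb f) ≤ a := by
  rw [convexConjugate_le_iff]
  refine ⟨fun h f => h _ (toBb_mem_Cb f), fun h f hf => ?_⟩
  obtain ⟨g, rfl⟩ := exists_toBb_eq hf
  exact h g

/-- The conjugate over `C_b` is either `∞` or a real number. -/
theorem convexConjugate_Cb_eq_top_or_coe (φ : Bb Y → ℝ) (μ : FiniteMeasure Y) :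
    convexConjugate φ (Cb Y) μ = ⊤ ∨ ∃ c : ℝ, convexConjugate φ (Cb Y) μ = c := by
  have h := le_convexConjugate φ μ (toBb_mem_Cb (0 : BoundedContinuousFunction Y ℝ))
  induction hc : convexConjugate φ (Cb Y) μ with
  | bot => rw [hc] at h; exact absurd (le_bot_iff.1 h) (EReal.coe_ne_bot _)
  | top => exact .inl rfl
  | coe c => exact .inr ⟨c, rfl⟩

/-- An intersection of closed half-spaces, one for each bounded continuous test function. -/
theorem isClosed_setOf_convexConjugate_Cb_le (φ : Bb Y → ℝ) (a : ℝ) :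
    IsClosed {μ : FiniteMeasure Y | convexConjugate φ (Cb Y) μ ≤ a} := by
  simp only [convexConjugate_Cb_le_iff, Set.ofPred_forall]
  refine isClosed_iInter fun f => isClosed_le ?_ continuous_const
  exact (FiniteMeasure.continuous_integral_boundedContinuousFunction f).sub continuous_const

/-- The weak duality inequality. -/
theorem integral_sub_convexConjugate_le (φ : Bb Y → ℝ) (μ : FiniteMeasure Y) {f g : Bb Y}
    (hg : g ∈ Cb Y) (hfg : f ≤ g) :
    ((∫ y, (f : Y → ℝ) y ∂(μ : Measure Y) : ℝ) : EReal) - convexConjugate φ (Cb Y) μ ≤ φ g := by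
  have h := le_convexConjugate φ μ hg
  have hfg' := integral_mono (Bb.integrable f μ) (Bb.integrable g μ) hfg
  obtain hc | ⟨c, hc⟩ := convexConjugate_Cb_eq_top_or_coe φ μ
  · simp [hc]
  · rw [hc] at h ⊢
    rw [EReal.coe_le_coe_iff] at h
    rw [← EReal.coe_sub, EReal.coe_le_coe_iff]
    linarith

/-- The functional `φ` is tight on continuous functions: large functions supported away from a
suitable compact set are cheap. -/
def IsTightOnCb (φ : Bb Y → ℝ) : Prop :=
  ∀ M : ℝ, 0 < M → ∃ K : Set Y, IsCompact K ∧ ∀ f : BoundedContinuousFunction Y ℝ,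
    (∀ y, f y ≤ M) → (∀ y ∈ K, f y ≤ 0) → φ (toBb f) ≤ 1

theorem mass_le_of_convexConjugate_Cb_le {φ : Bb Y → ℝ} {μ : FiniteMeasure Y} {a : ℝ}
    (h : convexConjugate φ (Cb Y) μ ≤ a) : (μ.mass : ℝ) ≤ a + φ (toBb 1) := by
  have h1 := convexConjugate_Cb_le_iff.1 h 1
  have h2 : ∫ y, (1 : BoundedContinuousFunction Y ℝ) y ∂(μ : Measure Y) = μ.mass := by
    simp only [coe_one, Pi.one_apply, integral_const, smul_eq_mul, mul_one]
    rfl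
  linarith

/-- The conjugate is tested with continuous functions that vanish on `K`, lie between 0 and `M`, and
converge to `M` times the indicator of `Kᶜ`. -/
theorem mul_measure_compl_le_of_convexConjugate_Cb_le [HasOuterApproxClosed Y] {φ : Bb Y → ℝ}
    {μ : FiniteMeasure Y} {a M : ℝ} (h : convexConjugate φ (Cb Y) μ ≤ a) {K : Set Y}
    (hM : 0 ≤ M) (hKc : IsClosed K) (hK : ∀ f : BoundedContinuousFunction Y ℝ,
      (∀ y, f y ≤ M) → (∀ y ∈ K, f y ≤ 0) → φ (toBb f) ≤ 1) :
    M * (μ Kᶜ : ℝ) ≤ a + 1 := by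
  let f : ℕ → BoundedContinuousFunction Y ℝ := fun n =>
    .ofNormedAddCommGroup (fun y => M * (1 - (hKc.apprSeq n y : ℝ))) (by fun_prop) (M * 1)
      fun y => by
        have h1 : (hKc.apprSeq n y : ℝ) ≤ 1 := by
          exact_mod_cast HasOuterApproxClosed.apprSeq_apply_le_one hKc n y
        have h2 : 0 ≤ (hKc.apprSeq n y : ℝ) := NNReal.coe_nonneg _
        rw [Real.norm_eq_abs, abs_mul, abs_of_nonneg hM, abs_of_nonneg (by linarith)]
        gcongr
        linarith
  have hf : ∀ n y, f n y = M * (1 - (hKc.apprSeq n y : ℝ)) := fun n y => rfl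
  have hint : ∀ n, Integrable (fun y => (hKc.apprSeq n y : ℝ)) (μ : Measure Y) := fun n =>
    .of_bound (by fun_prop) 1 (.of_forall fun y => by
      simpa using HasOuterApproxClosed.apprSeq_apply_le_one hKc n y)
  have hφ : ∀ n, M * (μ.mass - ∫ y, (hKc.apprSeq n y : ℝ) ∂(μ : Measure Y)) ≤ a + 1 := fun n => by
    have h1 := convexConjugate_Cb_le_iff.1 h (f n)
    have h2 : φ (toBb (f n)) ≤ 1 := hK (f n)
      (fun y => by
        rw [hf]
        exact mul_le_of_le_one_right hM (by simp))
      (fun y hy => by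
        rw [hf, HasOuterApproxClosed.apprSeq_apply_eq_one hKc n hy]
        simp)
    have h3 : ∫ y, f n y ∂(μ : Measure Y)
        = M * (μ.mass - ∫ y, (hKc.apprSeq n y : ℝ) ∂(μ : Measure Y)) := by
      simp only [hf]
      rw [integral_const_mul, integral_sub (integrable_const _) (hint n)]
      simp only [integral_const, smul_eq_mul, mul_one]
      rfl
    linarith
  have hlim : Tendsto (fun n => ∫ y, (hKc.apprSeq n y : ℝ) ∂(μ : Measure Y)) atTop
      (𝓝 (μ K : ℝ)) := by
    have := (ENNReal.tendsto_toReal (measure_ne_top (μ : Measure Y) K)).comp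
      (HasOuterApproxClosed.tendsto_lintegral_apprSeq hKc (μ : Measure Y))
    refine this.congr fun n => ?_
    rw [integral_eq_lintegral_of_nonneg_ae (.of_forall fun y => NNReal.coe_nonneg _)
      (hint n).aestronglyMeasurable]
    simp
  have h1 := le_of_tendsto' ((tendsto_const_nhds.sub hlim).const_mul M) hφ
  have h2 : (μ Kᶜ : ℝ) = μ.mass - μ K := by
    have := measureReal_compl (μ := (μ : Measure Y)) hKc.measurableSet
    exact this
  rwa [h2]

/-- The conjugate bound controls mass and tails, so Prokhorov gives a convergent subsequence, whose
limit stays in the closed sublevel set. -/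
theorem isSeqCompact_setOf_convexConjugate_Cb_le [TopologicalSpace.MetrizableSpace Y]
    {φ : Bb Y → ℝ} (hφ : IsTightOnCb φ) (a : ℝ) :
    IsSeqCompact {μ : FiniteMeasure Y | convexConjugate φ (Cb Y) μ ≤ a} := by
  choose! K hK hKφ using hφ
  let := TopologicalSpace.metrizableSpaceMetric Y
  -- The tail bound `(a + 1) / M` at `M = n + 1`.
  let u : ℕ → ℝ≥0 := fun n => (a + 1).toNNReal * (1 / ((n : ℝ≥0) + 1))
  have hu : Tendsto u atTop (𝓝 0) := by
    simpa [u] using (tendsto_one_div_add_atTop_nhds_zero_nat (𝕜 := ℝ≥0)).const_mul (a + 1).toNNReal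
  have hpos : ∀ n : ℕ, (0 : ℝ) < n + 1 := fun n => by positivity
  have hP := isSeqCompact_finiteMeasure_mass_le_compl_isCompact_le
    (a + φ (toBb 1)).toNNReal hu (fun n => hK (n + 1) (hpos n))
  intro μ hμ
  obtain ⟨ν, -, s, hs, hlim⟩ := hP (x := μ) fun n => by
    refine ⟨NNReal.le_toNNReal_of_coe_le (mass_le_of_convexConjugate_Cb_le (hμ n)), fun k => ?_⟩
    have h := mul_measure_compl_le_of_convexConjugate_Cb_le (hμ n) (hpos k).le
      (hK _ (hpos k)).isClosed (hKφ _ (hpos k))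
    rw [← NNReal.coe_le_coe]
    simp only [u, NNReal.coe_mul, NNReal.coe_div, NNReal.coe_add, NNReal.coe_one,
      NNReal.coe_natCast]
    rw [mul_one_div, le_div_iff₀ (hpos k), mul_comm]
    exact h.trans (Real.le_coe_toNNReal _)
  exact ⟨ν, (isClosed_setOf_convexConjugate_Cb_le φ a).mem_of_tendsto hlim
    (.of_forall fun n => hμ (s n)), s, hs, hlim⟩

/-- Strong duality with attainment at bounded continuous functions. -/
theorem exists_convexConjugate_Cb_eq_of_continuous [T35Space Y] {φ : Bb Y → ℝ}
    (hmono : Monotone φ) (hconv : ConvexOn ℝ Set.univ φ) (hφ : IsTightOnCb φ)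
    (f : BoundedContinuousFunction Y ℝ) :
    ∃ μ : FiniteMeasure Y,
      convexConjugate φ (Cb Y) μ ≤ ((∫ y, f y ∂(μ : Measure Y) - φ (toBb f) : ℝ) : EReal) := by
  have hconv' : ConvexOn ℝ Set.univ fun g : BoundedContinuousFunction Y ℝ => φ (toBb g) := by
    have := hconv.comp_linearMap (toBb (Y := Y))
    rw [Set.preimage_univ] at this
    exact this
  obtain ⟨l, hl⟩ := hconv'.exists_linear_subgradient f
  have hl' : ∀ g, l g ≤ l f - φ (toBb f) + φ (toBb g) := fun g => by
    have := hl g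
    rw [map_sub] at this
    linarith
  have hpos : ∀ g, 0 ≤ g → 0 ≤ l g := fun g hg => by
    have h1 := hl (f - g)
    have h2 : φ (toBb (f - g)) ≤ φ (toBb f) := hmono (toBb_mono (sub_le_self f hg))
    rw [sub_sub_cancel_left, map_neg] at h1
    linarith
  obtain ⟨μ, hμ⟩ := exists_finiteMeasure_of_tight_positive_functional l hpos fun ε hε => by
    -- The subgradient inequality at `(b / ε) • g`, where `φ` is at most 1, gives `(b / ε) * l g ≤
    -- b`. The added 1 absorbs that value and keeps `b` positive.
    let b := |l f - φ (toBb f)| + 1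
    have hb : 0 < b := by positivity
    obtain ⟨K, hK, hKφ⟩ := hφ (b / ε) (by positivity)
    refine ⟨K, hK, fun g hg1 hg0 => ?_⟩
    have h1 : φ (toBb ((b / ε) • g)) ≤ 1 := hKφ _
      (fun y => mul_le_of_le_one_right (by positivity) (hg1 y))
      (fun y hy => mul_nonpos_of_nonneg_of_nonpos (by positivity) (hg0 y hy))
    have h2 := hl' ((b / ε) • g)
    rw [map_smul, smul_eq_mul] at h2
    have h3 : b / ε * l g ≤ b := by
      have := le_abs_self (l f - φ (toBb f))
      simp only [b] at h1 h2 ⊢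
      linarith
    rw [div_mul_eq_mul_div, div_le_iff₀ hε] at h3
    exact le_of_mul_le_mul_left h3 hb
  refine ⟨μ, convexConjugate_Cb_le_iff.2 fun g => ?_⟩
  rw [← hμ, ← hμ]
  linarith [hl' g]

/-- If bounded continuous functions decrease to `f`, then the values of `φ` along them converge to
the dual value at `f`, which is attained. -/
theorem exists_tendsto_isGreatest_of_antitone [TopologicalSpace.MetrizableSpace Y] {φ : Bb Y → ℝ}
    (hmono : Monotone φ) (hconv : ConvexOn ℝ Set.univ φ) (hφ : IsTightOnCb φ) {f : Bb Y}
    {F : ℕ → BoundedContinuousFunction Y ℝ} (hF : Antitone F)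
    (hlim : ∀ y, Tendsto (fun j => F j y) atTop (𝓝 ((f : Y → ℝ) y))) :
    ∃ L : ℝ, Tendsto (fun j => φ (toBb (F j))) atTop (𝓝 L) ∧ φ f ≤ L ∧
      IsGreatest (Set.range fun μ : FiniteMeasure Y =>
        ((∫ y, (f : Y → ℝ) y ∂(μ : Measure Y) : ℝ) : EReal) - convexConjugate φ (Cb Y) μ)
        (L : EReal) := by
  have hfF : ∀ j, f ≤ toBb (F j) := fun j y =>
    Antitone.le_of_tendsto (fun i k hik => hF hik y) (hlim y) j
  have hanti : Antitone fun j => φ (toBb (F j)) := fun i j hij => hmono (toBb_mono (hF hij))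
  have hbdd : BddBelow (Set.range fun j => φ (toBb (F j))) :=
    ⟨φ f, by rintro _ ⟨j, rfl⟩; exact hmono (hfF j)⟩
  have hL := tendsto_atTop_ciInf hanti hbdd
  set L := ⨅ j, φ (toBb (F j))
  have hfL : φ f ≤ L := le_ciInf fun j => hmono (hfF j)
  have hLF : ∀ j, L ≤ φ (toBb (F j)) := fun j => ciInf_le hbdd j
  refine ⟨L, hL, hfL, ?_, ?_⟩
  swap
  · rintro _ ⟨μ, rfl⟩
    exact ge_of_tendsto' ((continuous_coe_real_ereal.tendsto _).comp hL) fun j =>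
      integral_sub_convexConjugate_le φ μ (toBb_mem_Cb (F j)) (hfF j)
  choose μ hμ using fun j => exists_convexConjugate_Cb_eq_of_continuous hmono hconv hφ (F j)
  -- Optimality of `μ j` tested at `F j + 1` bounds its mass by `φ (F j + 1) - φ (F j)`, which is at
  -- most `B`.
  let B := φ (toBb (F 0 + 1)) - L
  have hmass : ∀ j, ((μ j).mass : ℝ) ≤ B := fun j => by
    have h1 := convexConjugate_Cb_le_iff.1 (hμ j) (F j + 1)
    have h2 : ∫ y, (F j + 1) y ∂(μ j : Measure Y)
        = ∫ y, F j y ∂(μ j : Measure Y) + (μ j).mass := by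
      simp only [coe_add, coe_one, Pi.add_apply, Pi.one_apply]
      rw [integral_add ((F j).integrable _) (integrable_const _)]
      simp only [integral_const, smul_eq_mul, mul_one]
      rfl
    have h3 : φ (toBb (F j + 1)) ≤ φ (toBb (F 0 + 1)) :=
      hmono (toBb_mono (add_le_add_left (hF (Nat.zero_le j)) 1))
    have := hLF j
    simp only [B]
    linarith
  have hint : ∀ j, ∫ y, F j y ∂(μ j : Measure Y) ≤ ‖F 0‖ * B := fun j => by
    calc ∫ y, F j y ∂(μ j : Measure Y) ≤ ∫ _, ‖F 0‖ ∂(μ j : Measure Y) :=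
          integral_mono ((F j).integrable _) (integrable_const _) fun y =>
            (hF (Nat.zero_le j) y).trans ((F 0).apply_le_norm y)
      _ = ‖F 0‖ * (μ j).mass := by
          simp only [integral_const, smul_eq_mul, mul_comm]
          rfl
      _ ≤ _ := by gcongr; exact hmass j
  have hmem : ∀ j, convexConjugate φ (Cb Y) (μ j) ≤ ((‖F 0‖ * B - L : ℝ) : EReal) := fun j =>
    (hμ j).trans (EReal.coe_le_coe_iff.2 (sub_le_sub (hint j) (hLF j)))
  obtain ⟨ν, -, s, hs, hν⟩ := isSeqCompact_setOf_convexConjugate_Cb_le hφ _ hmem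
  have hνint : ∀ g : BoundedContinuousFunction Y ℝ,
      Tendsto (fun j => ∫ y, g y ∂(μ (s j) : Measure Y)) atTop (𝓝 (∫ y, g y ∂(ν : Measure Y))) :=
    FiniteMeasure.tendsto_iff_forall_integral_tendsto.1 hν
  -- `F (s j)` varies together with the measure, so it is replaced by the larger fixed `F k` before
  -- passing to the weak limit; `k → ∞` comes afterwards.
  have hle : ∀ k (g : BoundedContinuousFunction Y ℝ),
      ∫ y, g y ∂(ν : Measure Y) - φ (toBb g) ≤ ∫ y, F k y ∂(ν : Measure Y) - L := fun k g => by
    refine le_of_tendsto_of_tendsto ((hνint g).sub_const _) ((hνint (F k)).sub_const _) ?_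
    filter_upwards [hs.tendsto_atTop.eventually_ge_atTop k] with j hj
    refine (convexConjugate_Cb_le_iff.1 (hμ (s j)) g).trans (sub_le_sub ?_ (hLF _))
    exact integral_mono ((F _).integrable _) ((F k).integrable _) (hF hj)
  have hνf : Tendsto (fun k => ∫ y, F k y ∂(ν : Measure Y)) atTop
      (𝓝 (∫ y, (f : Y → ℝ) y ∂(ν : Measure Y))) :=
    integral_tendsto_of_tendsto_of_antitone (fun k => (F k).integrable _) (Bb.integrable f ν)
      (.of_forall fun y i k hik => hF hik y) (.of_forall hlim)
  have hc : convexConjugate φ (Cb Y) ν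
      ≤ ((∫ y, (f : Y → ℝ) y ∂(ν : Measure Y) - L : ℝ) : EReal) :=
    convexConjugate_Cb_le_iff.2 fun g => ge_of_tendsto' (hνf.sub_const L) fun k => hle k g
  refine ⟨ν, le_antisymm ?_ ?_⟩
  · exact ge_of_tendsto' ((continuous_coe_real_ereal.tendsto _).comp hL) fun j =>
      integral_sub_convexConjugate_le φ ν (toBb_mem_Cb (F j)) (hfF j)
  · obtain hc' | ⟨c, hc'⟩ := convexConjugate_Cb_eq_top_or_coe φ ν
    · rw [hc'] at hc
      exact absurd (top_le_iff.1 hc) (EReal.coe_ne_top _)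
    · dsimp only
      rw [hc', EReal.coe_le_coe_iff] at hc
      rw [hc', ← EReal.coe_sub, EReal.coe_le_coe_iff]
      linarith

theorem exists_isGreatest_of_mem_Ub [TopologicalSpace.MetrizableSpace Y] {φ : Bb Y → ℝ}
    (hmono : Monotone φ) (hconv : ConvexOn ℝ Set.univ φ) (hφ : IsTightOnCb φ) {f : Bb Y}
    (hf : f ∈ Ub Y) :
    ∃ L : ℝ, φ f ≤ L ∧ IsGreatest (Set.range fun μ : FiniteMeasure Y =>
      ((∫ y, (f : Y → ℝ) y ∂(μ : Measure Y) : ℝ) : EReal) - convexConjugate φ (Cb Y) μ)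
      (L : EReal) := by
  obtain ⟨F, hF, hlim⟩ :=
    UpperSemicontinuous.exists_antitone_boundedContinuousFunction hf f.2.2
  obtain ⟨L, -, h⟩ := exists_tendsto_isGreatest_of_antitone hmono hconv hφ hF hlim
  exact ⟨L, h⟩

/-- Everything compares `φ f` with the dual maximum `L`, which is also the limit of `φ` along any
continuous sequence decreasing to `f`. -/
theorem tfae_duality_Ub [TopologicalSpace.MetrizableSpace Y] {φ : Bb Y → ℝ}
    (hmono : Monotone φ) (hconv : ConvexOn ℝ Set.univ φ) (hφ : IsTightOnCb φ) :
    List.TFAE [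
      ∀ f ∈ Ub Y,
        IsGreatest
          (Set.range fun μ : FiniteMeasure Y =>
            ((∫ x, (f : Y → ℝ) x ∂(μ : Measure Y) : ℝ) : EReal) - convexConjugate φ (Cb Y) μ)
          (φ f : EReal),
      ∀ f ∈ Ub Y, ∀ F : ℕ → Bb Y, (∀ j, F j ∈ Cb Y) → Antitone F →
        (∀ x, Tendsto (fun j => (F j : Y → ℝ) x) atTop (𝓝 ((f : Y → ℝ) x))) →
        Antitone (fun j => φ (F j)) ∧ Tendsto (fun j => φ (F j)) atTop (𝓝 (φ f)),
      ∀ f ∈ Ub Y, IsGLB (φ '' {g | g ∈ Cb Y ∧ f ≤ g}) (φ f),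
      ∀ μ : FiniteMeasure Y, convexConjugate φ (Cb Y) μ = convexConjugate φ (Ub Y) μ] := by
  tfae_have 1 → 2 := by
    intro h f hf F hFc hF hlim
    choose G hG using fun j => exists_toBb_eq (hFc j)
    obtain rfl : (fun j => toBb (G j)) = F := funext hG
    refine ⟨fun i j hij => hmono (hF hij), ?_⟩
    obtain ⟨L, hL, -, hgr⟩ :=
      exists_tendsto_isGreatest_of_antitone hmono hconv hφ (F := G) (fun i j hij => hF hij) hlim
    rwa [← EReal.coe_injective (hgr.unique (h f hf))]
  tfae_have 2 → 3 := by
    intro h f hf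
    obtain ⟨F, hF, hlim⟩ :=
      UpperSemicontinuous.exists_antitone_boundedContinuousFunction hf f.2.2
    refine ⟨?_, fun b hb => ?_⟩
    · rintro _ ⟨g, hg, rfl⟩
      exact hmono hg.2
    · refine ge_of_tendsto' (h f hf (fun j => toBb (F j)) (fun j => toBb_mem_Cb _)
        (fun i j hij => toBb_mono (hF hij)) hlim).2 fun j =>
          hb ⟨_, ⟨toBb_mem_Cb _, fun y => ?_⟩, rfl⟩
      exact Antitone.le_of_tendsto (fun i k hik => hF hik y) (hlim y) j
  tfae_have 3 → 4 := by
    intro h μ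
    refine le_antisymm (biSup_mono fun f (hf : Continuous (f : Y → ℝ)) => hf.upperSemicontinuous)
      (iSup₂_le fun f hf => ?_)
    obtain hc | ⟨c, hc⟩ := convexConjugate_Cb_eq_top_or_coe φ μ
    · simp [hc]
    -- Weak duality makes the left side a lower bound of `φ g` over continuous `g ≥ f`, and `φ f` is
    -- the greatest such bound.
    · have h1 : ∫ y, (f : Y → ℝ) y ∂(μ : Measure Y) - c ≤ φ f := (h f hf).2 <| by
        rintro _ ⟨g, hg, rfl⟩
        have := integral_sub_convexConjugate_le φ μ hg.1 hg.2
        rwa [hc, ← EReal.coe_sub, EReal.coe_le_coe_iff] at this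
      rw [hc, EReal.coe_le_coe_iff]
      linarith
  tfae_have 4 → 1 := by
    intro h f hf
    obtain ⟨L, hfL, hgr⟩ := exists_isGreatest_of_mem_Ub hmono hconv hφ hf
    suffices hLf : L ≤ φ f by rwa [hfL.antisymm hLf]
    obtain ⟨μ, hμ⟩ := hgr.1
    -- The maximizer has `C_b`-conjugate `∫ f dμ - L`. Its `U_b`-conjugate is at least `∫ f dμ - φ
    -- f`, so equality of the two forces `L ≤ φ f`.
    have h1 := le_convexConjugate φ μ hf
    rw [← h μ] at h1
    dsimp only at hμ
    obtain hc | ⟨c, hc⟩ := convexConjugate_Cb_eq_top_or_coe φ μ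
    · rw [hc, EReal.sub_top] at hμ
      exact absurd hμ (EReal.bot_ne_coe _)
    · rw [hc, ← EReal.coe_sub, EReal.coe_eq_coe_iff] at hμ
      rw [hc, EReal.coe_le_coe_iff] at h1
      linarith
  tfae_finish

end Duality

/-! ### Tightness on the product and conclusion -/

/-- Domination by a sum of tight functionals of the coordinates forces tightness. -/
theorem isTightOnCb_of_le_tsum {ι : Type*} [Countable ι] {X : ι → Type*}
    [∀ n, MetricSpace (X n)] [∀ n, MeasurableSpace (X n)] [∀ n, BorelSpace (X n)]
    {φn : ∀ n, BbPos (X n) → ℝ≥0} (hφn : ∀ n, IsTightFunctional (φn n))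
    {φ : Bb (ProductSpace X) → ℝ}
    (hdom : ∀ (f : Bb (ProductSpace X)) (g : ∀ n, BbPos (X n)),
      (∀ x, ((f : ProductSpace X → ℝ) x : EReal) ≤ ((oplus g x : ℝ≥0∞) : EReal)) →
        (φ f : EReal) ≤ ((∑' n, (φn n (g n) : ℝ≥0∞) : ℝ≥0∞) : EReal)) :
    IsTightOnCb φ := by
  intro M hM
  obtain ⟨ε, hε, c, hsum, hc⟩ := NNReal.exists_pos_sum_of_countable (one_ne_zero (α := ℝ≥0)) ι
  lift M to ℝ≥0 using hM.le
  choose K hK hKε using fun n => hφn n M (ε n) (by exact_mod_cast hM) (hε n)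
  refine ⟨Set.univ.pi K, isCompact_univ_pi hK, fun f hfM hfK => ?_⟩
  have h1 := hdom f.toBb (fun n => .indicatorConst (K n)ᶜ (hK n).measurableSet.compl M) ?_
  · have h2 : (∑' n, (φn n (.indicatorConst (K n)ᶜ (hK n).measurableSet.compl M) : ℝ≥0∞)) ≤ 1 :=
      calc _ ≤ ∑' n, (ε n : ℝ≥0∞) := ENNReal.tsum_le_tsum fun n => by exact_mod_cast hKε n
        _ = c := (ENNReal.hasSum_coe.2 hsum).tsum_eq
        _ ≤ 1 := by exact_mod_cast hc.le
    have h3 := h1.trans (EReal.coe_ennreal_le_coe_ennreal_iff.2 h2)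
    rw [EReal.coe_ennreal_one] at h3
    exact_mod_cast h3
  · intro x
    by_cases hx : x ∈ Set.univ.pi K
    · exact (EReal.coe_le_coe_iff.2 (hfK x hx)).trans (EReal.coe_ennreal_nonneg _)
    -- Outside the box one escaping coordinate already contributes `M` to `oplus`.
    · obtain ⟨n, hn⟩ : ∃ n, x n ∉ K n := by
        by_contra! h
        exact hx fun n _ => h n
      calc (f x : EReal) ≤ ((M : ℝ) : EReal) := EReal.coe_le_coe_iff.2 (hfM x)
        _ = ((M : ℝ≥0∞) : EReal) := rfl
        _ ≤ _ := by
          refine EReal.coe_ennreal_le_coe_ennreal_iff.2 (le_trans ?_ (ENNReal.le_tsum n))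
          simp [BbPos.indicatorConst, hn]

theorem mainTheorem2 {ι : Type*} [Countable ι] {X : ι → Type*}
    [∀ n, MetricSpace (X n)] [∀ n, MeasurableSpace (X n)] [∀ n, BorelSpace (X n)]
    (φn : ∀ n, BbPos (X n) → ℝ≥0) (hφn : ∀ n, IsTightFunctional (φn n))
    (φ : Bb (ProductSpace X) → ℝ) (hmono : Monotone φ) (hconv : ConvexOn ℝ Set.univ φ)
    (hdom : ∀ (f : Bb (ProductSpace X)) (g : ∀ n, BbPos (X n)),
      (∀ x, ((f : ProductSpace X → ℝ) x : EReal) ≤ ((oplus g x : ℝ≥0∞) : EReal)) →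
        (φ f : EReal) ≤ ((∑' n, (φn n (g n) : ℝ≥0∞) : ℝ≥0∞) : EReal)) :
    (∀ a : ℝ, IsSeqCompact
      {μ : FiniteMeasure (ProductSpace X) |
        convexConjugate φ (Cb (ProductSpace X)) μ ≤ (a : EReal)}) ∧
    List.TFAE [
      ∀ f ∈ Ub (ProductSpace X),
        IsGreatest
          (Set.range fun μ : FiniteMeasure (ProductSpace X) =>
            ((∫ x, (f : ProductSpace X → ℝ) x ∂(μ : Measure (ProductSpace X)) : ℝ) : EReal)
              - convexConjugate φ (Cb (ProductSpace X)) μ)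
          (φ f : EReal),
      ∀ f ∈ Ub (ProductSpace X), ∀ F : ℕ → Bb (ProductSpace X),
        (∀ j, F j ∈ Cb (ProductSpace X)) → Antitone F →
        (∀ x, Tendsto (fun j => (F j : ProductSpace X → ℝ) x) atTop
          (𝓝 ((f : ProductSpace X → ℝ) x))) →
        Antitone (fun j => φ (F j)) ∧ Tendsto (fun j => φ (F j)) atTop (𝓝 (φ f)),
      ∀ f ∈ Ub (ProductSpace X),
        IsGLB (φ '' {g | g ∈ Cb (ProductSpace X) ∧ f ≤ g}) (φ f),
      ∀ μ : FiniteMeasure (ProductSpace X),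
        convexConjugate φ (Cb (ProductSpace X)) μ = convexConjugate φ (Ub (ProductSpace X)) μ] := by
  have : TopologicalSpace.MetrizableSpace (ProductSpace X) :=
    inferInstanceAs (TopologicalSpace.MetrizableSpace (∀ n, X n))
  have hφ := isTightOnCb_of_le_tsum hφn hdom
  exact ⟨isSeqCompact_setOf_convexConjugate_Cb_le hφ, tfae_duality_Ub hmono hconv hφ⟩
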